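/- A ReLU network $\Phi:\mathbb{R}^{N_0}\to\mathbb{R}^{N_L}$ of depth $\mathcal{L}(\Phi)=L\ge 1$ is given by matrices $A_\ell\in\mathbb{R}^{N_\ell\times N_{\ell-1}}$ and vectors $b_\ell\in\mathbb{R}^{N_\ell}$, $\ell=1,\dots,L$, with all $N_\ell\ge 1$, and realizes $\Phi=W_L\circ\rho\circ W_{L-1}\circ\dots\circ\rho\circ W_1$, where $W_\ell(x)=A_\ell x+b_\ell$ and $\rho(t)=\max(t,0)$ acts componentwise. Its width is $\mathcal{W}(\Phi)=\max_{0\le\ell\le L}N_\ell$, its weight magnitude $\mathcal{B}(\Phi)$ is the largest absolute value of an entry of any $A_\ell$ or $b_\ell$, and its connectivity $\mathcal{M}(\Phi)$ is the total number of nonzero entries of all $A_\ell$ and $b_\ell$. Networks are assumed non-degenerate: every node in layers $0,\dots,L-1$ has at least one outgoing edge and every output node has at least one incoming edge (edges are the nonzero entries of the $A_\ell$). Let $\log$ denote the logarithm to base $2$. **Theorem.** There is a constant $C>0$ such that for all real $a,D>0$ and all $\varepsilon\in(0,1/2)$ there is a ReLU network $\Psi_{a,D,\varepsilon}:\mathbb{R}\to\mathbb{R}$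 with $$\mathcal{L}(\Psi_{a,D,\varepsilon})\le C\big((\log(\varepsilon^{-1}))^2+\log\lceil a\max\{1,D\}\rceil\big),\qquad \mathcal{W}(\Psi_{a,D,\varepsilon})\le 9,\qquad \mathcal{B}(\Psi_{a,D,\varepsilon})\le 1,$$ $$\mathcal{M}(\Psi_{a,D,\varepsilon})\le C\big((\log(\varepsilon^{-1}))^2+\log\lceil a\max\{1,D\}\rceil\big),$$ and $$\sup_{x\in[-D,D]}\big|\Psi_{a,D,\varepsilon}(x)-\cos(ax)\big|\le\varepsilon .$$ In particular, for $D\ge 1$ the depth and the connectivity are at most $C\big((\log(\varepsilon^{-1}))^2+\log\lceil aD\rceil\big)$. -/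

import Mathlib

open scoped NNReal

/-- ReLU networks with input dimension `n` and output dimension `m`, i.e. the data
`(A_1, b_1), …, (A_L, b_L)`, `L ≥ 1`, of the affine maps, listed from the input side:
`affine A b` is a network with the single affine map `x ↦ A x + b` (`L = 1`), and
`layer A b Φ` first applies `x ↦ A x + b`, then the ReLU in every component, then `Φ`. -/
inductive ReLUNetwork : ℕ → ℕ → Type
  | affine {n m : ℕ} (A : Matrix (Fin m) (Fin n) ℝ) (b : Fin m → ℝ) : ReLUNetwork n m
  | layer {n k m : ℕ} (A : Matrix (Fin k) (Fin n) ℝ) (b : Fin k → ℝ)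
      (Φ : ReLUNetwork k m) : ReLUNetwork n m

namespace ReLUNetwork

/-- The map `W_L ∘ ρ ∘ W_{L-1} ∘ ⋯ ∘ ρ ∘ W_1` realized by the network. -/
noncomputable def realize : {n m : ℕ} → ReLUNetwork n m → (Fin n → ℝ) → (Fin m → ℝ)
  | _, _, affine A b, x => A.mulVec x + b
  | _, _, layer A b Φ, x => Φ.realize (fun i => max ((A.mulVec x + b) i) 0)

/-- The depth `L`: the number of affine maps. -/
def depth : {n m : ℕ} → ReLUNetwork n m → ℕ
  | _, _, affine _ _ => 1
  | _, _, layer _ _ Φ => Φ.depth + 1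

/-- The width `max (N_0, …, N_L)`; input and output layers count. -/
def width : {n m : ℕ} → ReLUNetwork n m → ℕ
  | n, m, affine _ _ => max n m
  | n, _, layer _ _ Φ => max n Φ.width

/-- The largest absolute value of an entry of `A` or `b`. -/
noncomputable def affineMagnitude {n m : ℕ} (A : Matrix (Fin m) (Fin n) ℝ)
    (b : Fin m → ℝ) : ℝ≥0 :=
  max (Finset.univ.sup fun p : Fin m × Fin n => ‖A p.1 p.2‖₊)
    (Finset.univ.sup fun i : Fin m => ‖b i‖₊)

/-- The weight magnitude: the largest absolute value of an entry of some `A_ℓ` or `b_ℓ`. -/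
noncomputable def weightMagnitude : {n m : ℕ} → ReLUNetwork n m → ℝ≥0
  | _, _, affine A b => affineMagnitude A b
  | _, _, layer A b Φ => max (affineMagnitude A b) Φ.weightMagnitude

/-- The number of non-zero entries of `A` and `b`. -/
noncomputable def affineConnectivity {n m : ℕ} (A : Matrix (Fin m) (Fin n) ℝ)
    (b : Fin m → ℝ) : ℕ :=
  {p : Fin m × Fin n | A p.1 p.2 ≠ 0}.ncard + {i : Fin m | b i ≠ 0}.ncard

/-- The connectivity: the total number of non-zero entries of all `A_ℓ` and `b_ℓ`. -/
noncomputable def connectivity : {n m : ℕ} → ReLUNetwork n m → ℕ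
  | _, _, affine A b => affineConnectivity A b
  | _, _, layer A b Φ => affineConnectivity A b + Φ.connectivity

/-- Non-degeneracy: every node of the input layer and of the hidden layers has at least one
outgoing edge, and every node of the output layer has at least one incoming edge, an edge being a
non-zero entry of some `A_ℓ`. If the input dimension is positive, this forces all layers to
be non-empty. -/
def NonDegenerate : {n m : ℕ} → ReLUNetwork n m → Prop
  | _, _, affine A _ => (∀ j, ∃ i, A i j ≠ 0) ∧ (∀ i, ∃ j, A i j ≠ 0)
  | _, _, layer A _ Φ => (∀ j, ∃ i, A i j ≠ 0) ∧ Φ.NonDegenerate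

end ReLUNetwork

/-! Tent maps supply the frequency and logistic maps the accuracy. Since cos(π tent p) = cos(2πp),
iterating `tent` multiplies the frequency by powers of two, one layer each; this costs about log a
layers. There remains cos(πu) = 1 - 2 sin²(πu/2) on [0, 1]. The logistic map sends sin² t to sin²
2t, so j steps started from θ² ≈ sin² θ with θ = πu/2^(j+1) suffice
(`sinSqApprox_mem_and_abs_sub_le`). Each step is replaced by `tentSum M`, with error at most 4⁻ᴹ
(`tentSum_approx`). With j and M of order log(1/ε), this costs O(log²(1/ε)) layers. Every layer has
the same seven-node form, where repeated nodes replace large weights. -/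

namespace ReLUNetwork

/-! ### Tent and logistic maps -/

/-- The tent map, written with two ReLU units. -/
noncomputable def tent (p : ℝ) : ℝ := 2 * max p 0 - 4 * max (p - 1 / 2) 0

/-- Partial sums `∑_{k < M} 4⁻ᵏ tent^{k+1}`, which interpolate the logistic map `4 p (1 - p)`. -/
noncomputable def tentSum (M : ℕ) (p : ℝ) : ℝ :=
  ∑ k ∈ Finset.range M, (4⁻¹ : ℝ) ^ k * tent^[k + 1] p

/-- The logistic map. -/
def logistic (p : ℝ) : ℝ := 4 * p * (1 - p)

lemma tent_of_le {p : ℝ} (h₀ : 0 ≤ p) (h : p ≤ 1 / 2) : tent p = 2 * p := by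
  rw [tent, max_eq_left h₀, max_eq_right (by linarith)]; ring

lemma tent_of_ge {p : ℝ} (h : 1 / 2 ≤ p) : tent p = 2 - 2 * p := by
  rw [tent, max_eq_left (by linarith), max_eq_left (by linarith)]; ring

lemma tent_mem {p : ℝ} (hp : p ∈ Set.Icc (0 : ℝ) 1) : tent p ∈ Set.Icc (0 : ℝ) 1 := by
  obtain ⟨h₀, h₁⟩ := hp
  rcases le_total p (1 / 2) with h | h
  · rw [tent_of_le h₀ h]; constructor <;> linarith
  · rw [tent_of_ge h]; constructor <;> linarith

lemma iterate_tent_mem (n : ℕ) {p : ℝ} (hp : p ∈ Set.Icc (0 : ℝ) 1) :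
    tent^[n] p ∈ Set.Icc (0 : ℝ) 1 := by
  induction n generalizing p with
  | zero => simpa using hp
  | succ n ih => rw [Function.iterate_succ_apply]; exact ih (tent_mem hp)

lemma cos_pi_mul_tent {p : ℝ} (hp : p ∈ Set.Icc (0 : ℝ) 1) :
    Real.cos (Real.pi * tent p) = Real.cos (2 * (Real.pi * p)) := by
  rcases le_total p (1 / 2) with h | h
  · rw [tent_of_le hp.1 h]; ring_nf
  · rw [tent_of_ge h, show Real.pi * (2 - 2 * p) = 2 * Real.pi - 2 * (Real.pi * p) by ring,
      Real.cos_two_pi_sub]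

lemma cos_pi_mul_iterate_tent (n : ℕ) {p : ℝ} (hp : p ∈ Set.Icc (0 : ℝ) 1) :
    Real.cos (Real.pi * tent^[n] p) = Real.cos (2 ^ n * (Real.pi * p)) := by
  induction n with
  | zero => simp
  | succ n ih =>
    rw [Function.iterate_succ_apply', cos_pi_mul_tent (iterate_tent_mem n hp), Real.cos_two_mul, ih,
      pow_succ' 2 n, mul_assoc 2, Real.cos_two_mul]

lemma logistic_eq_tent_add {p : ℝ} (hp : p ∈ Set.Icc (0 : ℝ) 1) :
    logistic p = tent p + 4⁻¹ * logistic (tent p) := by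
  unfold logistic
  rcases le_total p (1 / 2) with h | h
  · rw [tent_of_le hp.1 h]; ring
  · rw [tent_of_ge h]; ring

lemma tentSum_succ (M : ℕ) (p : ℝ) :
    tentSum (M + 1) p = tent p + 4⁻¹ * tentSum M (tent p) := by
  rw [tentSum, Finset.sum_range_succ', tentSum, Finset.mul_sum, add_comm]
  simp [pow_succ', mul_assoc]

lemma logistic_le_one (p : ℝ) : logistic p ≤ 1 := by
  unfold logistic; nlinarith [sq_nonneg (2 * p - 1)]

lemma logistic_nonneg {p : ℝ} (hp : p ∈ Set.Icc (0 : ℝ) 1) : 0 ≤ logistic p :=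
  mul_nonneg (by linarith [hp.1]) (by linarith [hp.2])

/-- The logistic map solves f(p) = tent p + f(tent p)/4, and `tentSum` iterates this equation from
0, so the gap shrinks fourfold per term. -/
lemma tentSum_approx (M : ℕ) {p : ℝ} (hp : p ∈ Set.Icc (0 : ℝ) 1) :
    0 ≤ tentSum M p ∧ tentSum M p ≤ logistic p ∧ logistic p ≤ tentSum M p + (4⁻¹ : ℝ) ^ M := by
  induction M generalizing p with
  | zero => simp [tentSum, logistic_le_one, logistic_nonneg hp]
  | succ M ih =>
    obtain ⟨h₁, h₂, h₃⟩ := ih (tent_mem hp)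
    rw [tentSum_succ, logistic_eq_tent_add hp, pow_succ']
    refine ⟨?_, ?_, ?_⟩ <;> linarith [(tent_mem hp).1]

lemma tentSum_mem (M : ℕ) {p : ℝ} (hp : p ∈ Set.Icc (0 : ℝ) 1) :
    tentSum M p ∈ Set.Icc (0 : ℝ) 1 :=
  ⟨(tentSum_approx M hp).1, (tentSum_approx M hp).2.1.trans (logistic_le_one p)⟩

lemma abs_tentSum_sub_logistic_le (M : ℕ) {p : ℝ} (hp : p ∈ Set.Icc (0 : ℝ) 1) :
    |tentSum M p - logistic p| ≤ (4⁻¹ : ℝ) ^ M := by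
  obtain ⟨-, h₁, h₂⟩ := tentSum_approx M hp
  rw [abs_le]; constructor <;> linarith [pow_pos (show (0 : ℝ) < 4⁻¹ by norm_num) M]

lemma abs_logistic_sub_le {p q : ℝ} (hp : p ∈ Set.Icc (0 : ℝ) 1) (hq : q ∈ Set.Icc (0 : ℝ) 1) :
    |logistic p - logistic q| ≤ 4 * |p - q| := by
  have h : logistic p - logistic q = 4 * (p - q) * (1 - p - q) := by unfold logistic; ring
  have h' : |1 - p - q| ≤ 1 := by
    rw [abs_le]; constructor <;> linarith [hp.1, hp.2, hq.1, hq.2]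
  rw [h, abs_mul, abs_mul, abs_of_pos (by norm_num : (0 : ℝ) < 4)]
  exact mul_le_of_le_one_right (by positivity) h'

/-! ### Angle doubling and error propagation -/

lemma logistic_sin_sq (t : ℝ) : logistic (Real.sin t ^ 2) = Real.sin (2 * t) ^ 2 := by
  rw [logistic, Real.sin_two_mul, ← Real.cos_sq']; ring

lemma sin_sq_mem (t : ℝ) : Real.sin t ^ 2 ∈ Set.Icc (0 : ℝ) 1 :=
  ⟨sq_nonneg _, Real.sin_sq_le_one t⟩

lemma iterate_tentSum_mem (M j : ℕ) {p : ℝ} (hp : p ∈ Set.Icc (0 : ℝ) 1) :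
    (tentSum M)^[j] p ∈ Set.Icc (0 : ℝ) 1 := by
  induction j with
  | zero => simpa using hp
  | succ j ih => rw [Function.iterate_succ_apply']; exact tentSum_mem M ih

/-- With δ = 4⁻ᴹ, one step turns an error e into at most 4e + δ, hence e + δ into at most 4(e + δ).
Adding δ on both sides makes the recursion purely geometric. -/
lemma iterate_tentSum_approx (M j : ℕ) {p : ℝ} (hp : p ∈ Set.Icc (0 : ℝ) 1) (t : ℝ) :
    |(tentSum M)^[j] p - Real.sin (2 ^ j * t) ^ 2| + (4⁻¹ : ℝ) ^ M
      ≤ 4 ^ j * (|p - Real.sin t ^ 2| + (4⁻¹ : ℝ) ^ M) := by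
  induction j with
  | zero => simp
  | succ j ih =>
    have hm := iterate_tentSum_mem M j hp
    have h₁ := abs_tentSum_sub_logistic_le M hm
    have h₂ := abs_logistic_sub_le hm (sin_sq_mem (2 ^ j * t))
    rw [logistic_sin_sq, ← mul_assoc, ← pow_succ'] at h₂
    rw [Function.iterate_succ_apply', pow_succ (4 : ℝ), mul_right_comm]
    have h₃ := abs_sub_le (tentSum M ((tentSum M)^[j] p)) (logistic ((tentSum M)^[j] p))
      (Real.sin (2 ^ (j + 1) * t) ^ 2)
    linarith [pow_pos (show (0 : ℝ) < 4⁻¹ by norm_num) M]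

lemma abs_sq_sub_sin_sq_le {t : ℝ} (h₀ : 0 ≤ t) (h₁ : t ≤ 1) :
    |t ^ 2 - Real.sin t ^ 2| ≤ t ^ 4 / 2 := by
  rcases h₀.eq_or_lt with rfl | h
  · simp
  have hs := Real.sin_gt_sub_cube h
  have hs' := Real.sin_lt h
  have hs₀ : 0 ≤ Real.sin t := Real.sin_nonneg_of_nonneg_of_le_pi h₀ (by linarith [Real.pi_gt_three])
  rw [abs_of_nonneg (by nlinarith)]
  calc t ^ 2 - Real.sin t ^ 2 = (t - Real.sin t) * (t + Real.sin t) := by ring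
    _ ≤ (t ^ 3 / 4) * (2 * t) :=
      mul_le_mul (by linarith [pow_pos h 3]) (by linarith) (by linarith) (by positivity)
    _ = t ^ 4 / 2 := by ring

/-- The approximation of `sin² (π u / 2)` obtained from a quadratic initial value by `j`
approximate logistic steps. -/
noncomputable def sinSqApprox (M j : ℕ) (u : ℝ) : ℝ :=
  (tentSum M)^[j] (Real.pi ^ 2 / 4 ^ (j + 1)
    + -(Real.pi ^ 2 / 4 ^ (j + 1)) * tentSum M (1 / 2 + 1 / 2 * u))

lemma pi_sq_div_le_one {j : ℕ} (hj : 1 ≤ j) : Real.pi ^ 2 / 4 ^ (j + 1) ≤ 1 := by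
  rw [div_le_one (by positivity)]
  calc Real.pi ^ 2 ≤ 4 ^ 2 := by gcongr; exact Real.pi_le_four
    _ ≤ 4 ^ (j + 1) := pow_le_pow_right₀ (by norm_num) (by omega)

lemma sinSqApprox_mem_and_abs_sub_le {M j : ℕ} (hj : 1 ≤ j) {u : ℝ} (hu : u ∈ Set.Icc (0 : ℝ) 1) :
    sinSqApprox M j u ∈ Set.Icc (0 : ℝ) 1 ∧
      |sinSqApprox M j u - Real.sin (Real.pi * u / 2) ^ 2|
        ≤ 4 ^ j * (2 * (4⁻¹ : ℝ) ^ M) + 8 * (4⁻¹ : ℝ) ^ j := by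
  obtain ⟨hu₀, hu₁⟩ := hu
  have hq : 1 / 2 + 1 / 2 * u ∈ Set.Icc (0 : ℝ) 1 := by constructor <;> linarith
  obtain ⟨hF₀, hF₁⟩ := tentSum_mem M hq
  have hc₁ := pi_sq_div_le_one hj
  have hc₀ : 0 < Real.pi ^ 2 / 4 ^ (j + 1) := by positivity
  have hF := abs_tentSum_sub_logistic_le M hq
  -- For p = (1 + u)/2, 1 - 4p(1 - p) = (2p - 1)² = u²; so the exact initial value is θ².
  have hθ₂ : Real.pi ^ 2 / 4 ^ (j + 1) * (1 - logistic (1 / 2 + 1 / 2 * u))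
      = (Real.pi * u / 2 ^ (j + 1)) ^ 2 := by
    have : (4 : ℝ) ^ (j + 1) = (2 ^ (j + 1)) ^ 2 := by
      rw [← pow_mul, mul_comm, pow_mul]; norm_num
    rw [this, logistic]; field_simp; ring
  have hθ₀ : 0 ≤ Real.pi * u / 2 ^ (j + 1) := by positivity
  have hθ : Real.pi * u / 2 ^ (j + 1) ≤ 2 * 2⁻¹ ^ j := by
    rw [div_le_iff₀ (by positivity), pow_succ, inv_pow]
    have h : Real.pi * u ≤ 4 * 1 := mul_le_mul Real.pi_le_four hu₁ hu₀ (by norm_num)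
    have : (2 : ℝ) * (2 ^ j)⁻¹ * (2 ^ j * 2) = 4 := by field_simp; norm_num
    linarith
  have hθ₁ : Real.pi * u / 2 ^ (j + 1) ≤ 1 := by
    refine hθ.trans ?_
    have : (2⁻¹ : ℝ) ^ j ≤ 2⁻¹ ^ 1 := pow_le_pow_of_le_one (by norm_num) (by norm_num) hj
    linarith
  have hsin := abs_sq_sub_sin_sq_le hθ₀ hθ₁
  -- Fourth order in θ gives 16⁻ʲ, which survives the amplification by 4ʲ.
  have hθ₄ : (Real.pi * u / 2 ^ (j + 1)) ^ 4 / 2 ≤ 8 * ((4⁻¹ : ℝ) ^ j * 4⁻¹ ^ j) := by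
    have : (Real.pi * u / 2 ^ (j + 1)) ^ 4 ≤ (2 * 2⁻¹ ^ j) ^ 4 := pow_le_pow_left₀ hθ₀ hθ 4
    have h₄ : (4⁻¹ : ℝ) ^ j = (2⁻¹ ^ j) ^ 2 := by
      rw [← pow_mul, mul_comm, pow_mul]; norm_num
    rw [h₄]; nlinarith
  rw [sinSqApprox]
  generalize Real.pi ^ 2 / 4 ^ (j + 1) = c at *
  generalize hθd : Real.pi * u / 2 ^ (j + 1) = θ at *
  have hmem : c + -c * tentSum M (1 / 2 + 1 / 2 * u) ∈ Set.Icc (0 : ℝ) 1 := by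
    constructor <;> nlinarith
  refine ⟨iterate_tentSum_mem M j hmem, ?_⟩
  have happ := iterate_tentSum_approx M j hmem θ
  have hang : 2 ^ j * θ = Real.pi * u / 2 := by
    rw [← hθd, pow_succ]; field_simp
  rw [hang] at happ
  have h₀ : |c + -c * tentSum M (1 / 2 + 1 / 2 * u) - Real.sin θ ^ 2|
      ≤ (4⁻¹ : ℝ) ^ M + 8 * ((4⁻¹ : ℝ) ^ j * 4⁻¹ ^ j) := by
    have hd : c + -c * tentSum M (1 / 2 + 1 / 2 * u) - Real.sin θ ^ 2
        = -(c * (tentSum M (1 / 2 + 1 / 2 * u) - logistic (1 / 2 + 1 / 2 * u)))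
          + (θ ^ 2 - Real.sin θ ^ 2) := by rw [← hθ₂]; ring
    rw [hd]
    refine (abs_add_le _ _).trans (add_le_add ?_ (hsin.trans hθ₄))
    rw [abs_neg, abs_mul, abs_of_pos hc₀]
    exact (mul_le_of_le_one_left (abs_nonneg _) hc₁).trans hF
  have h44 : (4 : ℝ) ^ j * 4⁻¹ ^ j = 1 := by rw [← mul_pow]; norm_num
  have hδ := pow_pos (show (0 : ℝ) < 4⁻¹ by norm_num) M
  calc _ ≤ 4 ^ j * (|c + -c * tentSum M (1 / 2 + 1 / 2 * u) - Real.sin θ ^ 2| + (4⁻¹ : ℝ) ^ M) := by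
        linarith
    _ ≤ 4 ^ j * ((4⁻¹ : ℝ) ^ M + 8 * ((4⁻¹ : ℝ) ^ j * 4⁻¹ ^ j) + (4⁻¹ : ℝ) ^ M) := by gcongr
    _ = 4 ^ j * (2 * (4⁻¹ : ℝ) ^ M) + 8 * (4 ^ j * 4⁻¹ ^ j) * 4⁻¹ ^ j := by ring
    _ = _ := by rw [h44]; ring

lemma one_sub_two_mul_sin_sq_half (t : ℝ) : 1 - 2 * Real.sin (t / 2) ^ 2 = Real.cos t := by
  rw [show Real.cos t = Real.cos (2 * (t / 2)) by congr 1; ring, Real.cos_two_mul, Real.sin_sq]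
  ring

/-! ### Seven-node layers -/

/-- The coefficients of one hidden layer. The layer carries the pair of preactivations `(P, Q)` to
`(α + β ρ(Q) + γ tent(P), δ ρ(Q) + η tent(P))`. -/
structure TentStep where
  (α β γ δ η : ℝ)

namespace TentStep

/-- The action of a layer on the pair of preactivations. -/
noncomputable def act (s : TentStep) (z : ℝ × ℝ) : ℝ × ℝ :=
  (s.α + s.β * max z.2 0 + s.γ * tent z.1, s.δ * max z.2 0 + s.η * tent z.1)

/-- The weight matrix of a layer: six rows for copies of `P`, one for `Q`. -/
def weights (s : TentStep) : Matrix (Fin 7) (Fin 7) ℝ :=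
  let p : Fin 7 → ℝ := ![s.γ, s.γ, -s.γ, -s.γ, -s.γ, -s.γ, s.β]
  ![p, p, p, p, p, p, ![s.η, s.η, -s.η, -s.η, -s.η, -s.η, s.δ]]

/-- The bias of a layer. -/
noncomputable def bias (s : TentStep) : Fin 7 → ℝ :=
  ![s.α, s.α, s.α - 1 / 2, s.α - 1 / 2, s.α - 1 / 2, s.α - 1 / 2, 0]

/-- All weights are at most one in absolute value, and no column of the weight matrix vanishes. -/
def Admissible (s : TentStep) : Prop :=
  (0 ≤ s.α ∧ s.α ≤ 1) ∧ |s.β| ≤ 1 ∧ |s.γ| ≤ 1 ∧ |s.δ| ≤ 1 ∧ |s.η| ≤ 1 ∧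
    (s.β ≠ 0 ∨ s.δ ≠ 0) ∧ (s.γ ≠ 0 ∨ s.η ≠ 0)

end TentStep

/-- The outputs of the seven nodes of a hidden layer with preactivations `(P, Q)`. -/
noncomputable def tentNodes (z : ℝ × ℝ) : Fin 7 → ℝ :=
  ![max z.1 0, max z.1 0, max (z.1 - 1 / 2) 0, max (z.1 - 1 / 2) 0, max (z.1 - 1 / 2) 0,
    max (z.1 - 1 / 2) 0, max z.2 0]

/-- Two copies of ρ(P) and four of ρ(P - 1/2) produce the coefficients 2 and -4 of `tent` with
weights bounded by one. -/
lemma relu_weights_mulVec_add_bias (s : TentStep) (z : ℝ × ℝ) :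
    (fun i => max ((s.weights.mulVec (tentNodes z) + s.bias) i) 0) = tentNodes (s.act z) := by
  have h (x y c d : ℝ) (e : x + y = c + d) : max (x + y) 0 = max (c + d) 0 := by rw [e]
  funext i
  fin_cases i <;>
    simp [TentStep.weights, TentStep.bias, TentStep.act, tentNodes, Matrix.mulVec, dotProduct,
      Fin.sum_univ_succ, tent] <;> congr 1 <;> ring

/-- The network with hidden layers prescribed by a list, reading off `1 - 2 ρ(P) + ρ(Q)`. -/
noncomputable def ofTentSteps : List TentStep → ReLUNetwork 7 1
  | [] => affine ![![-1, -1, 1, -1, 1, -1, 1]] ![1]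
  | s :: l => layer s.weights s.bias (ofTentSteps l)

lemma realize_ofTentSteps (l : List TentStep) (z : ℝ × ℝ) :
    (ofTentSteps l).realize (tentNodes z) 0
      = 1 - 2 * max (l.foldl (fun z s => s.act z) z).1 0
        + max (l.foldl (fun z s => s.act z) z).2 0 := by
  induction l generalizing z with
  | nil =>
    simp [ofTentSteps, realize, tentNodes, Matrix.mulVec, dotProduct, Fin.sum_univ_succ]
    ring
  | cons s l ih =>
    rw [ofTentSteps, realize, relu_weights_mulVec_add_bias, ih, List.foldl_cons]

lemma depth_ofTentSteps (l : List TentStep) : (ofTentSteps l).depth = l.length + 1 := by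
  induction l with
  | nil => rfl
  | cons s l ih => rw [ofTentSteps, depth, ih, List.length_cons]

lemma width_ofTentSteps (l : List TentStep) : (ofTentSteps l).width = 7 := by
  induction l with
  | nil => rfl
  | cons s l ih => rw [ofTentSteps, width, ih]; rfl

lemma affineMagnitude_le_one {n m : ℕ} {A : Matrix (Fin m) (Fin n) ℝ} {b : Fin m → ℝ}
    (hA : ∀ i j, |A i j| ≤ 1) (hb : ∀ i, |b i| ≤ 1) : affineMagnitude A b ≤ 1 :=
  max_le (Finset.sup_le fun p _ => by rw [← NNReal.coe_le_coe]; simpa using hA p.1 p.2)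
    (Finset.sup_le fun i _ => by rw [← NNReal.coe_le_coe]; simpa using hb i)

lemma affineConnectivity_le {n m : ℕ} (A : Matrix (Fin m) (Fin n) ℝ) (b : Fin m → ℝ) :
    affineConnectivity A b ≤ m * n + m := by
  unfold affineConnectivity
  gcongr
  · refine (Set.ncard_le_card _).trans ?_
    simp
  · refine (Set.ncard_le_card _).trans ?_
    simp

lemma weightMagnitude_ofTentSteps_le (l : List TentStep) (hl : ∀ s ∈ l, s.Admissible) :
    (ofTentSteps l).weightMagnitude ≤ 1 := by
  induction l with
  | nil =>
    refine affineMagnitude_le_one ?_ ?_ <;> simp [Fin.forall_fin_succ]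
  | cons s l ih =>
    obtain ⟨⟨h₀, h₁⟩, hβ, hγ, hδ, hη, -⟩ := hl s (by simp)
    refine max_le (affineMagnitude_le_one ?_ ?_) (ih fun t ht => hl t (by simp [ht]))
    · simp [Fin.forall_fin_succ, TentStep.weights, *]
    · have : |s.α| ≤ 1 := abs_le.2 ⟨by linarith, h₁⟩
      have : |s.α - 2⁻¹| ≤ 1 := abs_le.2 ⟨by linarith, by linarith⟩
      simp [Fin.forall_fin_succ, TentStep.bias, *]

lemma connectivity_ofTentSteps_le (l : List TentStep) :
    (ofTentSteps l).connectivity ≤ 56 * (l.length + 1) := by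
  induction l with
  | nil => exact (affineConnectivity_le _ _).trans (by norm_num)
  | cons s l ih =>
    rw [ofTentSteps, connectivity, List.length_cons]
    have := affineConnectivity_le s.weights s.bias
    omega

lemma nonDegenerate_ofTentSteps (l : List TentStep) (hl : ∀ s ∈ l, s.Admissible) :
    (ofTentSteps l).NonDegenerate := by
  induction l with
  -- The readout weights on the four copies of ρ(P - 1/2) cancel as 1, -1, 1, -1 rather than vanish,
  -- so these nodes keep outgoing edges.
  | nil => exact ⟨by simp [Fin.forall_fin_succ], by simp [Fin.exists_fin_succ]⟩
  | cons s l ih =>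
    obtain ⟨-, -, -, -, -, h₁, h₂⟩ := hl s (by simp)
    refine ⟨?_, ih fun t ht => hl t (by simp [ht])⟩
    simp only [Fin.forall_fin_succ, Fin.exists_fin_succ, TentStep.weights]
    simp [h₁, h₂]

/-! ### Layer blocks and their composition -/

/-- Apply the tent map to `P` and add `c` times the result to the accumulator `Q`. -/
def tentTick (c : ℝ) : TentStep := ⟨0, 0, 1, 1, c⟩

/-- Close an accumulation of `M + 1` terms and start afresh from `α + β Q`. -/
noncomputable def tentReset (M : ℕ) (α β : ℝ) : TentStep := ⟨α, β, β * (4⁻¹ : ℝ) ^ M, 0, 0⟩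

/-- Layers carrying `(p, 0)` to `(α + β tentSum (M + 1) p, 0)`. -/
noncomputable def tentBlock (M : ℕ) (α β : ℝ) : List TentStep :=
  (List.range M).map (fun k => tentTick ((4⁻¹ : ℝ) ^ k)) ++ [tentReset M α β]

lemma tentTick_admissible {c : ℝ} (hc : |c| ≤ 1) : (tentTick c).Admissible := by
  simp [tentTick, TentStep.Admissible, hc]

lemma abs_inv_four_pow_le (k : ℕ) : |(4⁻¹ : ℝ) ^ k| ≤ 1 := by
  rw [abs_of_nonneg (by positivity)]
  exact pow_le_one₀ (by norm_num) (by norm_num)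

lemma tentReset_admissible (M : ℕ) {α β : ℝ} (h₀ : 0 ≤ α) (h₁ : α ≤ 1) (hβ : |β| ≤ 1)
    (hβ₀ : β ≠ 0) : (tentReset M α β).Admissible := by
  have h : |β * (4⁻¹ : ℝ) ^ M| ≤ 1 := by
    rw [abs_mul]; exact mul_le_one₀ hβ (abs_nonneg _) (abs_inv_four_pow_le M)
  exact ⟨⟨h₀, h₁⟩, hβ, h, by simp [tentReset], by simp [tentReset], Or.inl hβ₀,
    Or.inl (mul_ne_zero hβ₀ (by positivity))⟩

lemma tentBlock_admissible (M : ℕ) {α β : ℝ} (h₀ : 0 ≤ α) (h₁ : α ≤ 1) (hβ : |β| ≤ 1)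
    (hβ₀ : β ≠ 0) : ∀ s ∈ tentBlock M α β, s.Admissible := by
  intro s hs
  simp only [tentBlock, List.mem_append, List.mem_map, List.mem_singleton] at hs
  rcases hs with ⟨k, -, rfl⟩ | rfl
  · exact tentTick_admissible (abs_inv_four_pow_le k)
  · exact tentReset_admissible M h₀ h₁ hβ hβ₀

lemma foldl_ticks (M : ℕ) {p : ℝ} (hp : p ∈ Set.Icc (0 : ℝ) 1) :
    ((List.range M).map (fun k => tentTick ((4⁻¹ : ℝ) ^ k))).foldl (fun z s => s.act z) (p, 0)
      = (tent^[M] p, tentSum M p) := by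
  induction M with
  | zero => simp [tentSum]
  | succ M ih =>
    rw [List.range_succ, List.map_append, List.foldl_append, ih]
    simp only [List.map_cons, List.map_nil, List.foldl_cons, List.foldl_nil, TentStep.act, tentTick]
    rw [max_eq_left (tentSum_mem M hp).1, tentSum, tentSum, Finset.sum_range_succ,
      Function.iterate_succ_apply']
    simp

lemma foldl_tentBlock (M : ℕ) (α β : ℝ) {p : ℝ} (hp : p ∈ Set.Icc (0 : ℝ) 1) :
    (tentBlock M α β).foldl (fun z s => s.act z) (p, 0) = (α + β * tentSum (M + 1) p, 0) := by
  rw [tentBlock, List.foldl_append, foldl_ticks M hp]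
  simp only [List.foldl_cons, List.foldl_nil, TentStep.act, tentReset]
  rw [max_eq_left (tentSum_mem M hp).1, tentSum, tentSum, Finset.sum_range_succ,
    Function.iterate_succ_apply']
  simp only [zero_mul, add_zero, Prod.mk.injEq, and_true]
  ring

lemma foldl_replicate_tentTick_zero (n : ℕ) (p : ℝ) :
    (List.replicate n (tentTick 0)).foldl (fun z s => s.act z) (p, 0) = (tent^[n] p, 0) := by
  induction n generalizing p with
  | zero => rfl
  | succ n ih =>
    rw [List.replicate_succ, List.foldl_cons, Function.iterate_succ_apply, ← ih]
    simp [TentStep.act, tentTick]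

lemma foldl_flatten_replicate_tentBlock (M j : ℕ) {p : ℝ} (hp : p ∈ Set.Icc (0 : ℝ) 1) :
    (List.replicate j (tentBlock M 0 1)).flatten.foldl (fun z s => s.act z) (p, 0)
      = ((tentSum (M + 1))^[j] p, 0) := by
  induction j generalizing p with
  | zero => rfl
  | succ j ih =>
    rw [List.replicate_succ, List.flatten_cons, List.foldl_append, foldl_tentBlock M 0 1 hp,
      zero_add, one_mul, ih (tentSum_mem _ hp), Function.iterate_succ_apply]

/-- The hidden layers of the cosine network. -/
noncomputable def cosSteps (n M j : ℕ) : List TentStep :=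
  List.replicate n (tentTick 0) ++ ⟨1 / 2, 1, 1 / 2, 0, 0⟩ ::
    (tentBlock M (Real.pi ^ 2 / 4 ^ (j + 1)) (-(Real.pi ^ 2 / 4 ^ (j + 1)))
      ++ (List.replicate j (tentBlock M 0 1)).flatten)

lemma cosSteps_admissible (n M : ℕ) {j : ℕ} (hj : 1 ≤ j) :
    ∀ s ∈ cosSteps n M j, s.Admissible := by
  have hc₁ := pi_sq_div_le_one hj
  have hc₀ : 0 < Real.pi ^ 2 / 4 ^ (j + 1) := by positivity
  intro s hs
  simp only [cosSteps, List.mem_append, List.mem_cons, List.mem_flatten] at hs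
  rcases hs with h | rfl | h | ⟨l, h, hs⟩
  · rw [List.eq_of_mem_replicate h]; exact tentTick_admissible (by simp)
  · norm_num [TentStep.Admissible, abs_le]
  · exact tentBlock_admissible M hc₀.le hc₁ (by rwa [abs_neg, abs_of_pos hc₀])
      (neg_ne_zero.2 hc₀.ne') s h
  · rw [List.eq_of_mem_replicate h] at hs
    exact tentBlock_admissible M le_rfl zero_le_one (by simp) one_ne_zero s hs

lemma length_cosSteps (n M j : ℕ) : (cosSteps n M j).length = n + 1 + (j + 1) * (M + 1) := by
  simp [cosSteps, tentBlock]; ring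

lemma foldl_cosSteps (n M : ℕ) {j : ℕ} (hj : 1 ≤ j) {p : ℝ} (hp : p ∈ Set.Icc (0 : ℝ) 1) :
    (cosSteps n M j).foldl (fun z s => s.act z) (p, 0)
      = (sinSqApprox (M + 1) j (tent^[n + 1] p), 0) := by
  obtain ⟨hu₀, hu₁⟩ := iterate_tent_mem (n + 1) hp
  have hq : 1 / 2 + 1 / 2 * tent^[n + 1] p ∈ Set.Icc (0 : ℝ) 1 := by constructor <;> linarith
  obtain ⟨hF₀, hF₁⟩ := tentSum_mem (M + 1) hq
  have hc₁ := pi_sq_div_le_one hj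
  have hc₀ : 0 < Real.pi ^ 2 / 4 ^ (j + 1) := by positivity
  -- This layer performs the last of the n + 1 tent maps. Its β = 1 multiplies Q = 0 and only keeps
  -- the Q node non-degenerate.
  have hstep : TentStep.act ⟨1 / 2, 1, 1 / 2, 0, 0⟩ (tent^[n] p, 0)
      = (1 / 2 + 1 / 2 * tent^[n + 1] p, 0) := by
    simp [TentStep.act, Function.iterate_succ_apply']
  rw [cosSteps, List.foldl_append, foldl_replicate_tentTick_zero, List.foldl_cons, hstep,
    List.foldl_append, foldl_tentBlock _ _ _ hq, foldl_flatten_replicate_tentBlock, sinSqApprox]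
  constructor <;> nlinarith

/-! ### The cosine network -/

/-- The weight matrix of the input layer of the cosine network. -/
def cosInputWeights (κ : ℝ) : Matrix (Fin 7) (Fin 1) ℝ :=
  ![![κ], ![κ], ![κ], ![κ], ![κ], ![κ], ![0]]

/-- The bias of the input layer of the cosine network. -/
noncomputable def cosInputBias : Fin 7 → ℝ := ![1 / 2, 1 / 2, 0, 0, 0, 0, 0]

/-- The cosine network: an affine map of the input into `[0, 1]`, `n + 1` tent maps which unfold the
periods, and the approximation of one period. -/
noncomputable def cosNetwork (κ : ℝ) (n M j : ℕ) : ReLUNetwork 1 1 :=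
  layer (cosInputWeights κ) cosInputBias (ofTentSteps (cosSteps n M j))

lemma realize_cosNetwork (κ : ℝ) (n M j : ℕ) (x : ℝ) :
    (cosNetwork κ n M j).realize ![x] 0
      = (ofTentSteps (cosSteps n M j)).realize (tentNodes (1 / 2 + κ * x, 0)) 0 := by
  rw [cosNetwork, realize]
  congr 2
  funext i
  fin_cases i <;> simp [cosInputWeights, cosInputBias, tentNodes, Matrix.mulVec, dotProduct, add_comm]

lemma abs_realize_cosNetwork_sub_cos_le {κ x : ℝ} (hκ : |κ * x| ≤ 1 / 2) {n M j : ℕ} (hn : 1 ≤ n)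
    (hj : 1 ≤ j) :
    |(cosNetwork κ n M j).realize ![x] 0 - Real.cos (2 ^ (n + 1) * Real.pi * κ * x)|
      ≤ 2 * (4 ^ j * (2 * (4⁻¹ : ℝ) ^ (M + 1)) + 8 * (4⁻¹ : ℝ) ^ j) := by
  obtain ⟨h₁, h₂⟩ := abs_le.1 hκ
  have hp : 1 / 2 + κ * x ∈ Set.Icc (0 : ℝ) 1 := by constructor <;> linarith
  obtain ⟨⟨hs, -⟩, herr⟩ := sinSqApprox_mem_and_abs_sub_le (M := M + 1) hj
    (iterate_tent_mem (n + 1) hp)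
  have hcos : Real.cos (Real.pi * tent^[n + 1] (1 / 2 + κ * x))
      = Real.cos (2 ^ (n + 1) * Real.pi * κ * x) := by
    -- The input shift 1/2 becomes the phase 2ⁿπ, a multiple of 2π because n ≥ 1.
    obtain ⟨k, rfl⟩ := Nat.exists_eq_add_of_le' hn
    rw [cos_pi_mul_iterate_tent _ hp, 
      ← Real.cos_add_nat_mul_two_pi (2 ^ (k + 1 + 1) * Real.pi * κ * x) (2 ^ k)]
    congr 1; push_cast; ring
  rw [realize_cosNetwork, realize_ofTentSteps, foldl_cosSteps n M hj hp, ← hcos,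
    ← one_sub_two_mul_sin_sq_half, max_eq_left hs, max_self, add_zero]
  rw [show ∀ y z : ℝ, 1 - 2 * y - (1 - 2 * z) = -(2 * (y - z)) by intros; ring, abs_neg, abs_mul,
    abs_two]
  gcongr

lemma depth_cosNetwork (κ : ℝ) (n M j : ℕ) :
    (cosNetwork κ n M j).depth = n + 3 + (j + 1) * (M + 1) := by
  rw [cosNetwork, depth, depth_ofTentSteps, length_cosSteps]; ring

lemma width_cosNetwork (κ : ℝ) (n M j : ℕ) : (cosNetwork κ n M j).width = 7 := by
  rw [cosNetwork, width, width_ofTentSteps]; rfl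

lemma weightMagnitude_cosNetwork_le {κ : ℝ} (hκ : |κ| ≤ 1) (n M : ℕ) {j : ℕ} (hj : 1 ≤ j) :
    (cosNetwork κ n M j).weightMagnitude ≤ 1 := by
  have : (2⁻¹ : ℝ) ≤ 1 := by norm_num
  refine max_le (affineMagnitude_le_one ?_ ?_)
    (weightMagnitude_ofTentSteps_le _ (cosSteps_admissible n M hj)) <;>
    simp [Fin.forall_fin_succ, cosInputWeights, cosInputBias, *]

lemma nonDegenerate_cosNetwork {κ : ℝ} (hκ : κ ≠ 0) (n M : ℕ) {j : ℕ} (hj : 1 ≤ j) :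
    (cosNetwork κ n M j).NonDegenerate :=
  ⟨fun i => ⟨0, by fin_cases i; exact hκ⟩, nonDegenerate_ofTentSteps _ (cosSteps_admissible n M hj)⟩

lemma connectivity_cosNetwork_le (κ : ℝ) (n M j : ℕ) :
    (cosNetwork κ n M j).connectivity ≤ 56 * (cosNetwork κ n M j).depth := by
  have h := connectivity_ofTentSteps_le (cosSteps n M j)
  rw [← depth_ofTentSteps] at h
  rw [cosNetwork, connectivity, depth]
  have := affineConnectivity_le (cosInputWeights κ) cosInputBias
  omega

end ReLUNetwork

/-! ### Choice of parameters -/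

lemma two_pow_clog_ge (m : ℕ) : (m : ℝ) ≤ 2 ^ Nat.clog 2 m := by
  exact_mod_cast Nat.le_pow_clog (by norm_num) m

lemma clog_two_le_logb_add_one {m : ℕ} (hm : 1 ≤ m) :
    (Nat.clog 2 m : ℝ) ≤ Real.logb 2 m + 1 := by
  have h := Nat.ceil_lt_add_one (Real.logb_nonneg one_lt_two (by exact_mod_cast hm : (1 : ℝ) ≤ m))
  have h' : ⌈Real.logb 2 (m : ℝ)⌉₊ = Nat.clog 2 m := Real.natCeil_logb_natCast 2 m
  rw [h'] at h
  exact h.le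

open ReLUNetwork in
theorem mainTheorem6 :
    ∃ C : ℝ, 0 < C ∧ ∀ a D ε : ℝ, 0 < a → 0 < D → 0 < ε → ε < 1 / 2 →
      ∃ Ψ : ReLUNetwork 1 1,
        Ψ.NonDegenerate ∧
        (Ψ.depth : ℝ) ≤ C * ((Real.logb 2 ε⁻¹) ^ 2 + Real.logb 2 (⌈a * max 1 D⌉₊ : ℝ)) ∧
        Ψ.width ≤ 9 ∧
        Ψ.weightMagnitude ≤ 1 ∧
        (Ψ.connectivity : ℝ) ≤
          C * ((Real.logb 2 ε⁻¹) ^ 2 + Real.logb 2 (⌈a * max 1 D⌉₊ : ℝ)) ∧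
        ∀ x ∈ Set.Icc (-D) D, |Ψ.realize ![x] 0 - Real.cos (a * x)| ≤ ε := by
  -- Depth is at most 70 times the bracket, and a layer has at most 7·7 + 7 = 56 entries.
  refine ⟨56 * 70, by norm_num, fun a D ε ha hD hε hε₂ => ?_⟩
  set m := ⌈a * max 1 D⌉₊ with hm
  have hm₁ : 1 ≤ m := Nat.ceil_pos.2 (by positivity)
  set ℓ := Real.logb 2 ε⁻¹ with hℓ
  have hℓ₁ : 1 ≤ ℓ := by
    rw [hℓ, Real.le_logb_iff_rpow_le one_lt_two (by positivity), Real.rpow_one, le_inv_comm₀ two_pos hε]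
    linarith
  set N := ⌈ℓ⌉₊
  have hN : (N : ℝ) ≤ ℓ + 1 := (Nat.ceil_lt_add_one (by linarith)).le
  have hNε : ε⁻¹ ≤ 2 ^ N := by
    have := (Real.logb_le_iff_le_rpow one_lt_two (by positivity)).1 (Nat.le_ceil ℓ)
    rwa [Real.rpow_natCast] at this
  -- The extra 1 secures n ≥ 1 when m = 1.
  set n := Nat.clog 2 m + 1 with hn
  have hn_le : (n : ℝ) ≤ Real.logb 2 m + 2 := by
    have := clog_two_le_logb_add_one hm₁
    rw [hn]; push_cast; linarith
  have hmn : (m : ℝ) ≤ 2 ^ n :=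
    (two_pow_clog_ge m).trans (pow_le_pow_right₀ one_le_two (Nat.le_succ _))
  have hceil : a * max 1 D ≤ m := Nat.le_ceil _
  have ha_le : a ≤ 2 ^ n := by nlinarith [le_max_left 1 D]
  have haD_le : a * D ≤ 2 ^ n := by nlinarith [le_max_right 1 D]
  set κ := a / (2 ^ (n + 1) * Real.pi) with hκ
  have hκ₀ : 0 < κ := by positivity
  have hpi := Real.pi_gt_three
  have h2n : (0 : ℝ) < 2 ^ n := by positivity
  have hκ₁ : κ ≤ 1 := by
    rw [hκ, div_le_one (by positivity), pow_succ]; nlinarith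
  have hlogm : 0 ≤ Real.logb 2 (m : ℝ) :=
    Real.logb_nonneg one_lt_two (by exact_mod_cast hm₁)
  -- With j = N + 3, the sums have M + 1 = 2j terms: the amplified truncation error 4ʲ·4⁻²ʲ then
  -- matches the 4⁻ʲ of the initial value.
  have hdepth : ((cosNetwork κ n (2 * N + 5) (N + 3)).depth : ℝ)
      ≤ 70 * (ℓ ^ 2 + Real.logb 2 (m : ℝ)) := by
    rw [depth_cosNetwork]; push_cast
    have : ((N : ℝ) + 3 + 1) * (2 * N + 5 + 1) ≤ (6 * ℓ) * (10 * ℓ) := by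
      gcongr <;> linarith
    nlinarith
  refine ⟨cosNetwork κ n (2 * N + 5) (N + 3), nonDegenerate_cosNetwork hκ₀.ne' _ _ (by omega), ?_,
    by rw [width_cosNetwork]; norm_num, weightMagnitude_cosNetwork_le (by rwa [abs_of_pos hκ₀]) _ _ (by omega), ?_,
    fun x hx => ?_⟩
  · nlinarith
  · have h : ((cosNetwork κ n (2 * N + 5) (N + 3)).connectivity : ℝ)
        ≤ 56 * (cosNetwork κ n (2 * N + 5) (N + 3)).depth := by
      exact_mod_cast connectivity_cosNetwork_le κ n (2 * N + 5) (N + 3)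
    linarith
  · have hκx : |κ * x| ≤ 1 / 2 := by
      rw [abs_mul, abs_of_pos hκ₀]
      calc κ * |x| ≤ κ * D := by gcongr; exact abs_le.2 hx
        _ ≤ 1 / 2 := by
          rw [hκ, div_mul_eq_mul_div, div_le_iff₀ (by positivity), pow_succ]; nlinarith
    have key := abs_realize_cosNetwork_sub_cos_le hκx (n := n) (M := 2 * N + 5) (j := N + 3)
      (by omega) (by omega)
    rw [show 2 ^ (n + 1) * Real.pi * κ * x = a * x by rw [hκ]; field_simp] at key
    refine key.trans ?_
    have h44 : (4 : ℝ) ^ (N + 3) * 4⁻¹ ^ (N + 3) = 1 := by rw [← mul_pow]; norm_num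
    have hpow : (4⁻¹ : ℝ) ^ (2 * N + 5 + 1) = 4⁻¹ ^ (N + 3) * 4⁻¹ ^ (N + 3) := by
      rw [← pow_add]; congr 1; ring
    have h4N : (4⁻¹ : ℝ) ^ N ≤ ε := by
      calc (4⁻¹ : ℝ) ^ N ≤ 2⁻¹ ^ N := by gcongr; norm_num
        _ = (2 ^ N)⁻¹ := inv_pow _ _
        _ ≤ ε := inv_le_of_inv_le₀ hε hNε
    calc _ = 2 * (2 * ((4 : ℝ) ^ (N + 3) * 4⁻¹ ^ (N + 3)) * 4⁻¹ ^ (N + 3) + 8 * 4⁻¹ ^ (N + 3)) := by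
          rw [hpow]; ring
      _ = 20 / 64 * 4⁻¹ ^ N := by rw [h44, pow_add]; ring
      _ ≤ ε := by nlinarith
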